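/- Let $H\in(0,1/2)$ and $\alpha\in(0,2H)$. There exists a constant $C_{\alpha,H}\in(0,\infty)$, depending only on $\alpha$ and $H$, such that the following holds. Let $(\beta^H(t))_{t\ge 0}$ be a real-valued fractional Brownian motion with Hurst index $H$, that is, a centred Gaussian process with almost surely continuous paths and covariance $\mathbb E[\beta^H(t)\beta^H(s)]=\frac12\bigl(t^{2H}+s^{2H}-|t-s|^{2H}\bigr)$ for all $t,s\ge 0$. For $\lambda\in(0,\infty)$, let the real-valued fractional Ornstein--Uhlenbeck process be $$\mathcal Z^{H,\lambda}(t)=\int_0^t e^{-\lambda(t-s)}\,\mathrm d\beta^H(s),\qquad t\ge 0,$$ where for $\phi:[0,T]\to\mathbb R$ of class $C^1$ one sets $\int_0^T\phi(s)\,\mathrm d\beta^H(s)=\phi(T)\beta^H(T)-\int_0^T\phi'(s)\beta^H(s)\,\mathrm ds$. Then for all $\lambda\in(0,\infty)$ and all $t_1,t_2\ge 0$, the increment $\mathcal Z^{H,\lambda}(t_2)-\mathcal Z^{H,\lambda}(t_1)$ is square integrable and $$\mathbb E\bigl[|\mathcal Z^{H,\lambda}(t_2)-\mathcal Z^{H,\lambda}(t_1)|^2\bigr]\le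 C_{\alpha,H}\,\lambda^{\alpha-2H}\,|t_2-t_1|^{\alpha}.$$ -/

import Mathlib

open MeasureTheory ProbabilityTheory
open scoped NNReal

/-- The process `β`, indexed by times `t ≥ 0`, is a real-valued fractional Brownian motion with
Hurst index `H` under `P`: a centred Gaussian process with covariance
`(t ^ (2 H) + s ^ (2 H) - |t - s| ^ (2 H)) / 2`, with almost surely continuous paths. -/
structure IsFractionalBrownianMotion {Ω : Type*} [MeasurableSpace Ω]
    (H : ℝ) (β : ℝ≥0 → Ω → ℝ) (P : Measure Ω) : Prop where
  isGaussianProcess : IsGaussianProcess β P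
  mean_eq_zero : ∀ t : ℝ≥0, ∫ ω, β t ω ∂P = 0
  covariance_eq : ∀ t s : ℝ≥0, ∫ ω, β t ω * β s ω ∂P =
    (1 / 2) * ((t : ℝ) ^ (2 * H) + (s : ℝ) ^ (2 * H) - |(t : ℝ) - (s : ℝ)| ^ (2 * H))
  continuous_paths : ∀ᵐ ω ∂P, Continuous fun t : ℝ≥0 => β t ω

/-- The stochastic integral `∫₀ᵀ φ(t) dβ(t)` of a deterministic integrand `φ` of class `C¹` with
respect to a process `β` starting at `0`:
`φ(T) β(T) - ∫₀ᵀ φ'(t) β(t) dt`, where the last integral is taken path by path. -/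
noncomputable def stochIntegral {Ω : Type*} (β : ℝ≥0 → Ω → ℝ) (φ : ℝ → ℝ) (T : ℝ≥0) (ω : Ω) : ℝ :=
  φ T * β T ω - ∫ t in (0 : ℝ)..(T : ℝ), deriv φ t * β t.toNNReal ω

/-- The real-valued fractional Ornstein-Uhlenbeck process driven by `β`, with parameter `lam`:
`Z(t) = ∫₀ᵗ exp (-lam (t - s)) dβ(s)`. -/
noncomputable def fractionalOU {Ω : Type*} (β : ℝ≥0 → Ω → ℝ) (lam : ℝ) (t : ℝ≥0) (ω : Ω) : ℝ :=
  stochIntegral β (fun s : ℝ => Real.exp (-lam * ((t : ℝ) - s))) t ω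

/-! Integration by parts is built into the stochastic integral, so path by path `Z(t) = β(t) - ∫₀ᵗ
lam e^{-lam(t-s)} β(s) ds`. The kernel has mass `1 - e^{-lam t}`, hence `Z(t)` is `e^{-lam t} β(t)`
plus a weighted average of the increments `β(t) - β(s)`. Jensen and `E|β(t) - β(s)|² = |t-s|^{2H}`
bound `E Z(t)²` by a multiple of `lam^{-2H}`, uniformly in `t` (`ouTransform_memLp`).

Restarting at time `a` (`ouTransform_sub`) also bounds the second moment of an increment of length
`h` by a multiple of `h^{2H}`. Interpolating between the two bounds (`le_rpow_interpolate`) gives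
`lam^{α-2H} h^α`. Gaussianity serves only to make `β` square integrable. -/

/-! ### The exponential kernel -/

section Kernel

/-- Jensen for a sub-probability weight: expand `∫ w (f - c)² ≥ 0` at `c = ∫ w f`; mass at most one
controls the `c²` term. -/
lemma sq_integral_mul_le_of_weight {w f : ℝ → ℝ} {a b : ℝ} (hab : a ≤ b) (hw : Continuous w)
    (hf : Continuous f) (hw0 : ∀ s, 0 ≤ w s) (hw1 : ∫ s in a..b, w s ≤ 1) :
    (∫ s in a..b, w s * f s) ^ 2 ≤ ∫ s in a..b, w s * f s ^ 2 := by
  have e (c : ℝ) : ∫ s in a..b, w s * (f s - c) ^ 2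
      = (∫ s in a..b, w s * f s ^ 2) - 2 * c * (∫ s in a..b, w s * f s)
        + c ^ 2 * ∫ s in a..b, w s := by
    rw [← intervalIntegral.integral_const_mul, ← intervalIntegral.integral_const_mul,
      ← intervalIntegral.integral_sub, ← intervalIntegral.integral_add]
    · congr 1
      ext s
      ring
    all_goals exact Continuous.intervalIntegrable (by fun_prop) _ _
  set c := ∫ s in a..b, w s * f s
  have h0 : 0 ≤ ∫ s in a..b, w s * (f s - c) ^ 2 :=
    intervalIntegral.integral_nonneg hab fun s _ => mul_nonneg (hw0 s) (sq_nonneg _)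
  rw [e] at h0
  nlinarith [sq_nonneg c]

lemma integral_expKernel {lam : ℝ} (a t : ℝ) :
    ∫ s in a..t, lam * Real.exp (-lam * (t - s)) = 1 - Real.exp (-lam * (t - a)) := by
  have := intervalIntegral.integral_eq_sub_of_hasDerivAt
    (f := fun s => Real.exp (-lam * (t - s)))
    (f' := fun s => lam * Real.exp (-lam * (t - s))) (a := a) (b := t) (fun s _ => by
      have h : HasDerivAt (fun s : ℝ => -lam * (t - s)) lam s := by
        simpa using ((hasDerivAt_id s).const_sub t).const_mul (-lam)
      simpa [mul_comm] using h.exp)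
    (Continuous.intervalIntegrable (by fun_prop) _ _)
  simpa using this

lemma integral_expKernel_le_one {lam : ℝ} (a t : ℝ) :
    ∫ s in a..t, lam * Real.exp (-lam * (t - s)) ≤ 1 := by
  rw [integral_expKernel]
  linarith [Real.exp_pos (-lam * (t - a))]

lemma continuous_abs_sub_rpow {p : ℝ} (hp : 0 ≤ p) (t : ℝ) :
    Continuous fun s : ℝ => |t - s| ^ p :=
  (by fun_prop : Continuous fun s : ℝ => |t - s|).rpow_const fun _ => Or.inr hp

lemma rpow_mul_exp_neg_le {p x : ℝ} (hp0 : 0 ≤ p) (hp1 : p ≤ 1) (hx : 0 ≤ x) :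
    x ^ p * Real.exp (-x) ≤ 2 * Real.exp (-(x / 2)) := by
  have h1 : x ^ p ≤ 1 + x := by
    rcases le_total x 1 with h | h
    · linarith [Real.rpow_le_one hx h hp0]
    · have := Real.rpow_le_rpow_of_exponent_le h hp1
      rw [Real.rpow_one] at this
      linarith
  have h2 : 1 + x ≤ 2 * Real.exp (x / 2) := by linarith [Real.add_one_le_exp (x / 2)]
  calc x ^ p * Real.exp (-x) ≤ 2 * Real.exp (x / 2) * Real.exp (-x) := by
        gcongr
        exact h1.trans h2
    _ = 2 * Real.exp (-(x / 2)) := by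
        rw [mul_assoc, ← Real.exp_add]
        ring_nf

/-- Half of the decay absorbs the power; the other half is kept, so that what remains is again an
exponential kernel, of rate `lam / 2`. -/
lemma rpow_mul_exp_neg_mul_le {p lam u : ℝ} (hp0 : 0 ≤ p) (hp1 : p ≤ 1) (hlam : 0 < lam)
    (hu : 0 ≤ u) :
    u ^ p * Real.exp (-lam * u) ≤ 2 * lam ^ (-p) * Real.exp (-(lam / 2) * u) := by
  have h := rpow_mul_exp_neg_le hp0 hp1 (mul_nonneg hlam.le hu)
  have e : u ^ p = lam ^ (-p) * (lam * u) ^ p := by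
    rw [Real.mul_rpow hlam.le hu, ← mul_assoc, ← Real.rpow_add hlam]
    simp
  have hl : 0 ≤ lam ^ (-p) := Real.rpow_nonneg hlam.le _
  calc u ^ p * Real.exp (-lam * u)
      = lam ^ (-p) * ((lam * u) ^ p * Real.exp (-(lam * u))) := by rw [e]; ring_nf
    _ ≤ lam ^ (-p) * (2 * Real.exp (-(lam * u / 2))) := by gcongr
    _ = _ := by ring_nf

lemma integral_expKernel_mul_rpow_le_length {p lam a t : ℝ} (hp : 0 ≤ p) (hlam : 0 < lam)
    (hat : a ≤ t) :
    ∫ s in a..t, lam * Real.exp (-lam * (t - s)) * |t - s| ^ p ≤ (t - a) ^ p := by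
  have hcont := continuous_abs_sub_rpow hp t
  calc _ ≤ ∫ s in a..t, lam * Real.exp (-lam * (t - s)) * (t - a) ^ p := by
        refine intervalIntegral.integral_mono_on hat
          (Continuous.intervalIntegrable (by fun_prop) _ _)
          (Continuous.intervalIntegrable (by fun_prop) _ _) fun s hs => ?_
        rw [abs_of_nonneg (by linarith [hs.2])]
        have : t - s ≤ t - a := by linarith [hs.1]
        have : 0 ≤ t - s := by linarith [hs.2]
        gcongr
    _ ≤ (t - a) ^ p := by
        rw [intervalIntegral.integral_mul_const]
        exact mul_le_of_le_one_left (Real.rpow_nonneg (by linarith) _)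
          (integral_expKernel_le_one a t)

lemma integral_expKernel_mul_rpow_le_rate {p lam a t : ℝ} (hp0 : 0 ≤ p) (hp1 : p ≤ 1)
    (hlam : 0 < lam) (hat : a ≤ t) :
    ∫ s in a..t, lam * Real.exp (-lam * (t - s)) * |t - s| ^ p ≤ 4 * lam ^ (-p) := by
  have hcont := continuous_abs_sub_rpow hp0 t
  calc _ ≤ ∫ s in a..t, 4 * lam ^ (-p) * (lam / 2 * Real.exp (-(lam / 2) * (t - s))) := by
        refine intervalIntegral.integral_mono_on hat
          (Continuous.intervalIntegrable (by fun_prop) _ _)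
          (Continuous.intervalIntegrable (by fun_prop) _ _) fun s hs => ?_
        have hu : 0 ≤ t - s := by linarith [hs.2]
        rw [abs_of_nonneg hu]
        have := mul_le_mul_of_nonneg_left (rpow_mul_exp_neg_mul_le hp0 hp1 hlam hu) hlam.le
        linarith
    _ ≤ 4 * lam ^ (-p) := by
        rw [intervalIntegral.integral_const_mul]
        exact mul_le_of_le_one_right (by positivity) (integral_expKernel_le_one a t)

end Kernel

/-! ### Second moments of sums and of time averages -/

section SecondMoment

variable {Ω : Type*} [MeasurableSpace Ω] {P : Measure Ω}

lemma integral_sq_add_le {X Y : Ω → ℝ} (hX : MemLp X 2 P) (hY : MemLp Y 2 P) :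
    ∫ ω, (X ω + Y ω) ^ 2 ∂P ≤ 2 * (∫ ω, X ω ^ 2 ∂P) + 2 * ∫ ω, Y ω ^ 2 ∂P := by
  rw [← integral_const_mul, ← integral_const_mul,
    ← integral_add (hX.integrable_sq.const_mul _) (hY.integrable_sq.const_mul _)]
  refine integral_mono (hX.add hY).integrable_sq
    ((hX.integrable_sq.const_mul _).add (hY.integrable_sq.const_mul _)) fun ω => ?_
  simp only
  nlinarith [sq_nonneg (X ω - Y ω)]

lemma integral_sq_add_add_le {X Y Z : Ω → ℝ} (hX : MemLp X 2 P) (hY : MemLp Y 2 P)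
    (hZ : MemLp Z 2 P) :
    ∫ ω, (X ω + Y ω + Z ω) ^ 2 ∂P
      ≤ 3 * (∫ ω, X ω ^ 2 ∂P) + 3 * (∫ ω, Y ω ^ 2 ∂P) + 3 * ∫ ω, Z ω ^ 2 ∂P := by
  have hX2 := hX.integrable_sq.const_mul 3
  have hY2 := hY.integrable_sq.const_mul 3
  have hZ2 := hZ.integrable_sq.const_mul 3
  have hXY2 : Integrable (fun ω => 3 * X ω ^ 2 + 3 * Y ω ^ 2) P := hX2.add hY2
  rw [← integral_const_mul, ← integral_const_mul, ← integral_const_mul,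
    ← integral_add hX2 hY2, ← integral_add hXY2 hZ2]
  refine integral_mono ((hX.add hY).add hZ).integrable_sq (hXY2.add hZ2) fun ω => ?_
  simp only
  nlinarith [sq_nonneg (X ω - Y ω), sq_nonneg (X ω - Z ω), sq_nonneg (Y ω - Z ω)]

lemma integral_const_mul_sq (c : ℝ) (X : Ω → ℝ) :
    ∫ ω, (c * X ω) ^ 2 ∂P = c ^ 2 * ∫ ω, X ω ^ 2 ∂P := by
  simp_rw [mul_pow, integral_const_mul]

/-- A weighted time average of a continuous process has second moment at most the weighted average
of the second moments. -/
lemma memLp_integral_weight [SFinite P] {X : ℝ → Ω → ℝ}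
    (hX : ∀ ω, Continuous fun s => X s ω) (hXm : ∀ s, Measurable (X s))
    {w v : ℝ → ℝ} {a b : ℝ} (hab : a ≤ b) (hw : Continuous w) (hv : Continuous v)
    (hw0 : ∀ s, 0 ≤ w s) (hw1 : ∫ s in a..b, w s ≤ 1)
    (hXL : ∀ s ∈ Set.Ioc a b, MemLp (X s) 2 P)
    (hXv : ∀ s ∈ Set.Ioc a b, ∫ ω, X s ω ^ 2 ∂P = v s) :
    MemLp (fun ω => ∫ s in a..b, w s * X s ω) 2 P ∧
      ∫ ω, (∫ s in a..b, w s * X s ω) ^ 2 ∂P ≤ ∫ s in a..b, w s * v s := by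
  have hXu : Measurable (Function.uncurry X) := measurable_uncurry_of_continuous_of_measurable hX hXm
  have hv0 : ∀ s ∈ Set.Ioc a b, 0 ≤ v s := fun s hs => by
    rw [← hXv s hs]
    exact integral_nonneg fun _ => sq_nonneg _
  have hYm : StronglyMeasurable fun ω => ∫ s in a..b, w s * X s ω := by
    simp_rw [intervalIntegral.integral_of_le hab]
    refine StronglyMeasurable.integral_prod_right (f := fun ω s => w s * X s ω) ?_
    exact ((hw.measurable.comp measurable_snd).mul
      (hXu.comp measurable_swap)).stronglyMeasurable
  -- With lower integrals Tonelli needs no integrability in advance, and one estimate gives both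
  -- square integrability and the bound.
  have hle : ∫⁻ ω, ENNReal.ofReal ((∫ s in a..b, w s * X s ω) ^ 2) ∂P
      ≤ ENNReal.ofReal (∫ s in a..b, w s * v s) := by
    calc _ ≤ ∫⁻ ω, (∫⁻ s in Set.Ioc a b, ENNReal.ofReal (w s * X s ω ^ 2)) ∂P := by
          refine lintegral_mono fun ω => ?_
          have hc := hX ω
          rw [← ofReal_integral_eq_lintegral_ofReal
            ((Continuous.intervalIntegrable (by fun_prop) a b).1)
            (Filter.Eventually.of_forall fun s => mul_nonneg (hw0 s) (sq_nonneg _)),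
            ← intervalIntegral.integral_of_le hab]
          exact ENNReal.ofReal_le_ofReal (sq_integral_mul_le_of_weight hab hw hc hw0 hw1)
      _ = ∫⁻ s in Set.Ioc a b, ∫⁻ ω, ENNReal.ofReal (w s * X s ω ^ 2) ∂P := by
          refine lintegral_lintegral_swap (Measurable.aemeasurable ?_)
          exact ((hw.measurable.comp measurable_snd).mul
            ((hXu.comp measurable_swap).pow_const 2)).ennreal_ofReal
      _ = ∫⁻ s in Set.Ioc a b, ENNReal.ofReal (w s * v s) := by
          refine setLIntegral_congr_fun measurableSet_Ioc fun s hs => ?_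
          rw [← ofReal_integral_eq_lintegral_ofReal ((hXL s hs).integrable_sq.const_mul _)
            (Filter.Eventually.of_forall fun ω => mul_nonneg (hw0 s) (sq_nonneg _)),
            integral_const_mul, hXv s hs]
      _ = _ := by
          rw [intervalIntegral.integral_of_le hab, ofReal_integral_eq_lintegral_ofReal
            ((Continuous.intervalIntegrable (by fun_prop) a b).1)]
          exact (ae_restrict_iff' measurableSet_Ioc).2
            (Filter.Eventually.of_forall fun s hs => mul_nonneg (hw0 s) (hv0 s hs))
  have hB : 0 ≤ ∫ s in a..b, w s * v s := by
    rw [intervalIntegral.integral_of_le hab]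
    exact setIntegral_nonneg measurableSet_Ioc fun s hs => mul_nonneg (hw0 s) (hv0 s hs)
  constructor
  · rw [memLp_two_iff_integrable_sq hYm.aestronglyMeasurable]
    refine ⟨(hYm.pow 2).aestronglyMeasurable, ?_⟩
    rw [hasFiniteIntegral_iff_ofReal (Filter.Eventually.of_forall fun _ => sq_nonneg _)]
    exact hle.trans_lt ENNReal.ofReal_lt_top
  · rw [integral_eq_lintegral_of_nonneg_ae (Filter.Eventually.of_forall fun _ => sq_nonneg _)
      (hYm.pow 2).aestronglyMeasurable]
    exact ENNReal.toReal_le_of_le_ofReal hB hle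

end SecondMoment

/-! ### Pathwise identities -/

/-- The pathwise fractional Ornstein-Uhlenbeck transform of a real function. -/
noncomputable def ouTransform (lam : ℝ) (g : ℝ → ℝ) (t : ℝ) : ℝ :=
  g t - ∫ s in (0 : ℝ)..t, lam * Real.exp (-lam * (t - s)) * g s

/-- The exponentially weighted average of the increments of `g` on `[a, t]`. -/
noncomputable def ouRemainder (lam : ℝ) (g : ℝ → ℝ) (a t : ℝ) : ℝ :=
  ∫ s in a..t, lam * Real.exp (-lam * (t - s)) * (g t - g s)

lemma ouRemainder_eq {g : ℝ → ℝ} (hg : Continuous g) (lam a t : ℝ) :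
    ouRemainder lam g a t = (1 - Real.exp (-lam * (t - a))) * g t
      - ∫ s in a..t, lam * Real.exp (-lam * (t - s)) * g s := by
  rw [ouRemainder, ← integral_expKernel, ← intervalIntegral.integral_mul_const,
    ← intervalIntegral.integral_sub]
  · simp_rw [mul_sub]
  all_goals exact Continuous.intervalIntegrable (by fun_prop) _ _

lemma ouTransform_eq {g : ℝ → ℝ} (hg : Continuous g) (lam t : ℝ) :
    ouTransform lam g t = Real.exp (-lam * t) * g t + ouRemainder lam g 0 t := by
  rw [ouRemainder_eq hg, ouTransform, sub_zero]
  ring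

/-- The kernel is multiplicative in time, so the past up to `a` enters the integral only through a
factor `e^{-lam(t-a)}`. -/
lemma ouTransform_sub {g : ℝ → ℝ} (hg : Continuous g) (lam a t : ℝ) :
    ouTransform lam g t - ouTransform lam g a =
      (Real.exp (-lam * (t - a)) - 1) * ouTransform lam g a
        + Real.exp (-lam * (t - a)) * (g t - g a) + ouRemainder lam g a t := by
  have hint : ∀ x y, IntervalIntegrable (fun s => lam * Real.exp (-lam * (t - s)) * g s)
      volume x y := fun x y => Continuous.intervalIntegrable (by fun_prop) _ _
  have e : ∫ s in (0 : ℝ)..a, lam * Real.exp (-lam * (t - s)) * g s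
      = Real.exp (-lam * (t - a)) * ∫ s in (0 : ℝ)..a, lam * Real.exp (-lam * (a - s)) * g s := by
    rw [← intervalIntegral.integral_const_mul]
    congr 1
    ext s
    rw [show -lam * (t - s) = -lam * (t - a) + -lam * (a - s) by ring, Real.exp_add]
    ring
  rw [ouRemainder_eq hg, ouTransform, ouTransform,
    ← intervalIntegral.integral_add_adjacent_intervals (hint 0 a) (hint a t), e]
  ring

/-! ### The two moment bounds -/

section Increments

variable {Ω : Type*} [MeasurableSpace Ω] {P : Measure Ω} {G : ℝ → Ω → ℝ} {p lam : ℝ}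

lemma ouRemainder_memLp [SFinite P] (hp : 0 ≤ p) (hlam : 0 < lam)
    (hG : ∀ ω, Continuous fun s => G s ω) (hGm : ∀ s, Measurable (G s))
    (hGL : ∀ s, MemLp (G s) 2 P)
    (hGv : ∀ s t, 0 ≤ s → 0 ≤ t → ∫ ω, (G t ω - G s ω) ^ 2 ∂P = |t - s| ^ p)
    {a t : ℝ} (ha : 0 ≤ a) (hat : a ≤ t) :
    MemLp (fun ω => ouRemainder lam (fun s => G s ω) a t) 2 P ∧
      ∫ ω, ouRemainder lam (fun s => G s ω) a t ^ 2 ∂P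
        ≤ ∫ s in a..t, lam * Real.exp (-lam * (t - s)) * |t - s| ^ p := by
  refine memLp_integral_weight (X := fun s ω => G t ω - G s ω)
    (w := fun s => lam * Real.exp (-lam * (t - s)))
    (fun ω => continuous_const.sub (hG ω)) (fun s => (hGm t).sub (hGm s)) hat (by fun_prop)
    (continuous_abs_sub_rpow hp t) (fun s => by positivity)
    (integral_expKernel_le_one a t) (fun s _ => (hGL t).sub (hGL s))
    (fun s hs => hGv s t (ha.trans hs.1.le) (ha.trans hat))

lemma ouTransform_memLp [SFinite P] (hp : 0 ≤ p) (hp1 : p ≤ 1) (hlam : 0 < lam)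
    (hG : ∀ ω, Continuous fun s => G s ω) (hGm : ∀ s, Measurable (G s))
    (hGL : ∀ s, MemLp (G s) 2 P)
    (hG2 : ∀ t, 0 ≤ t → ∫ ω, G t ω ^ 2 ∂P = t ^ p)
    (hGv : ∀ s t, 0 ≤ s → 0 ≤ t → ∫ ω, (G t ω - G s ω) ^ 2 ∂P = |t - s| ^ p)
    {t : ℝ} (ht : 0 ≤ t) :
    MemLp (fun ω => ouTransform lam (fun s => G s ω) t) 2 P ∧
      ∫ ω, ouTransform lam (fun s => G s ω) t ^ 2 ∂P ≤ 12 * lam ^ (-p) := by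
  obtain ⟨hR, hR2⟩ := ouRemainder_memLp hp hlam hG hGm hGL hGv le_rfl ht
  have hR2 := hR2.trans (integral_expKernel_mul_rpow_le_rate hp hp1 hlam ht)
  have hE := (hGL t).const_mul (Real.exp (-lam * t))
  have e : ∀ ω, ouTransform lam (fun s => G s ω) t =
    Real.exp (-lam * t) * G t ω + ouRemainder lam (fun s => G s ω) 0 t :=
    fun ω => ouTransform_eq (hG ω) lam t
  simp_rw [e]
  refine ⟨hE.add hR, (integral_sq_add_le hE hR).trans ?_⟩
  rw [integral_const_mul_sq, hG2 t ht]
  have hl : 0 < lam ^ (-p) := Real.rpow_pos_of_pos hlam _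
  have h1 := rpow_mul_exp_neg_mul_le hp hp1 hlam ht
  have h2 : Real.exp (-(lam / 2) * t) ≤ 1 := Real.exp_le_one_iff.2 (by nlinarith)
  have h3 : Real.exp (-lam * t) ≤ 1 := Real.exp_le_one_iff.2 (by nlinarith)
  have h4 : t ^ p * Real.exp (-lam * t) ≤ 2 * lam ^ (-p) :=
    h1.trans (mul_le_of_le_one_right (by positivity) h2)
  have h5 : Real.exp (-lam * t) ^ 2 * t ^ p ≤ 2 * lam ^ (-p) := by
    refine le_trans ?_ h4
    rw [sq, mul_assoc, mul_comm (t ^ p)]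
    exact mul_le_of_le_one_left (by positivity) h3
  linarith

/-- The increments of the transform are controlled by the two scales `(t - a) ^ p` and
`lam ^ (-p)`. -/
lemma ouTransform_sub_memLp [SFinite P] (hp : 0 ≤ p) (hp1 : p ≤ 1) (hlam : 0 < lam)
    (hG : ∀ ω, Continuous fun s => G s ω) (hGm : ∀ s, Measurable (G s))
    (hGL : ∀ s, MemLp (G s) 2 P)
    (hG2 : ∀ t, 0 ≤ t → ∫ ω, G t ω ^ 2 ∂P = t ^ p)
    (hGv : ∀ s t, 0 ≤ s → 0 ≤ t → ∫ ω, (G t ω - G s ω) ^ 2 ∂P = |t - s| ^ p)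
    {a t : ℝ} (ha : 0 ≤ a) (hat : a ≤ t) :
    MemLp (fun ω => ouTransform lam (fun s => G s ω) t - ouTransform lam (fun s => G s ω) a) 2 P ∧
      ∫ ω, (ouTransform lam (fun s => G s ω) t - ouTransform lam (fun s => G s ω) a) ^ 2 ∂P
        ≤ 48 * lam ^ (-p) ∧
      ∫ ω, (ouTransform lam (fun s => G s ω) t - ouTransform lam (fun s => G s ω) a) ^ 2 ∂P
        ≤ 48 * (t - a) ^ p := by
  have ht : 0 ≤ t := ha.trans hat
  obtain ⟨hT, hT2⟩ := ouTransform_memLp hp hp1 hlam hG hGm hGL hG2 hGv ht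
  obtain ⟨hA, hA2⟩ := ouTransform_memLp hp hp1 hlam hG hGm hGL hG2 hGv ha
  refine ⟨hT.sub hA, ?_, ?_⟩
  · have h := integral_sq_add_le hT hA.neg
    simp only [Pi.neg_apply, neg_sq, ← sub_eq_add_neg] at h
    linarith
  · obtain ⟨hR, hR2⟩ := ouRemainder_memLp hp hlam hG hGm hGL hGv ha hat
    have hR2 := hR2.trans (integral_expKernel_mul_rpow_le_length hp hlam hat)
    have hD : MemLp (fun ω => G t ω - G a ω) 2 P := (hGL t).sub (hGL a)
    have e : ∀ ω, ouTransform lam (fun s => G s ω) t - ouTransform lam (fun s => G s ω) a = _ :=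
      fun ω => ouTransform_sub (hG ω) lam a t
    simp_rw [e]
    refine (integral_sq_add_add_le (hA.const_mul _) (hD.const_mul _) hR).trans ?_
    rw [integral_const_mul_sq, integral_const_mul_sq, hGv a t ha ht,
      abs_of_nonneg (sub_nonneg.2 hat)]
    set h := t - a
    have hh : 0 ≤ h := sub_nonneg.2 hat
    set x := lam * h with hx
    have hx0 : 0 ≤ x := by positivity
    have he1 : Real.exp (-lam * h) ≤ 1 := Real.exp_le_one_iff.2 (by nlinarith)
    have he0 := Real.exp_pos (-lam * h)
    have he2 : 1 - Real.exp (-lam * h) ≤ x := by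
      have := Real.add_one_le_exp (-lam * h)
      rw [hx]
      linarith
    -- `1 - e^{-x}` is at most `min x 1`, which is at most `x ^ p` as `0 ≤ p ≤ 1`. The factor `x ^
    -- p` turns the uniform bound `lam ^ (-p)` into `h ^ p`.
    have hq : (Real.exp (-lam * h) - 1) ^ 2 ≤ x ^ p := by
      rcases le_total x 1 with hx1 | hx1
      · have : x ≤ x ^ p := by
          simpa using Real.rpow_le_rpow_of_exponent_ge' hx0 hx1 hp hp1
        nlinarith
      · have := Real.one_le_rpow hx1 hp
        nlinarith
    have hxp : x ^ p * lam ^ (-p) = h ^ p := by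
      rw [hx, Real.mul_rpow hlam.le hh, mul_right_comm, ← Real.rpow_add hlam]
      simp
    have hl : 0 < lam ^ (-p) := Real.rpow_pos_of_pos hlam _
    have hhp : 0 ≤ h ^ p := Real.rpow_nonneg hh _
    have b1 : (Real.exp (-lam * h) - 1) ^ 2 * ∫ ω, ouTransform lam (fun s => G s ω) a ^ 2 ∂P
        ≤ 12 * h ^ p := by
      calc _ ≤ x ^ p * (12 * lam ^ (-p)) := by gcongr
        _ = 12 * h ^ p := by rw [← hxp]; ring
    have b2 : Real.exp (-lam * h) ^ 2 * h ^ p ≤ h ^ p :=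
      mul_le_of_le_one_left hhp (pow_le_one₀ he0.le he1)
    -- The three terms give `3 * 12 + 3 + 3 = 42 ≤ 48`.
    linarith

end Increments

/-- After factoring out `lam ^ (-p)`, this is `min 1 (x ^ p) ≤ x ^ α` at `x = lam * h`, split at `x
= 1`. -/
lemma le_rpow_interpolate {p α lam h : ℝ} (hα0 : 0 ≤ α) (hα : α ≤ p) (hlam : 0 < lam)
    (hh : 0 ≤ h) {c y : ℝ} (hc : 0 ≤ c) (h1 : y ≤ c * lam ^ (-p)) (h2 : y ≤ c * h ^ p) :
    y ≤ c * lam ^ (α - p) * h ^ α := by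
  have hx0 : 0 ≤ lam * h := by positivity
  have e : c * lam ^ (α - p) * h ^ α = c * lam ^ (-p) * (lam * h) ^ α := by
    rw [Real.mul_rpow hlam.le hh, show α - p = -p + α by ring, Real.rpow_add hlam]
    ring
  have e2 : c * h ^ p = c * lam ^ (-p) * (lam * h) ^ p := by
    rw [Real.mul_rpow hlam.le hh, Real.rpow_neg hlam.le]
    field_simp
  rw [e]
  have hl : 0 < lam ^ (-p) := Real.rpow_pos_of_pos hlam _
  rcases le_total (lam * h) 1 with hx | hx
  · refine (h2.trans_eq e2).trans ?_
    gcongr ?_ * ?_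
    exact Real.rpow_le_rpow_of_exponent_ge' hx0 hx hα0 hα
  · exact h1.trans (le_mul_of_one_le_right (by positivity) (Real.one_le_rpow hx hα0))

/-! ### Regular version and conclusion -/

/-- A process with almost surely continuous paths and a.e. measurable marginals coincides almost
surely, at all times at once, with a process with continuous paths and measurable marginals. -/
lemma exists_continuous_measurable_ae_eq {ι Ω : Type*} [TopologicalSpace ι]
    [TopologicalSpace.SeparableSpace ι] [FrechetUrysohnSpace ι] [MeasurableSpace Ω]
    {P : Measure Ω} {X : ι → Ω → ℝ}
    (hX : ∀ i, AEMeasurable (X i) P) (hc : ∀ᵐ ω ∂P, Continuous fun i => X i ω) :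
    ∃ Y : ι → Ω → ℝ, (∀ ω, Continuous fun i => Y i ω) ∧ (∀ i, Measurable (Y i)) ∧
      ∀ᵐ ω ∂P, ∀ i, Y i ω = X i ω := by
  classical
  obtain ⟨D, hDc, hD⟩ := TopologicalSpace.exists_countable_dense ι
  have hDae : ∀ᵐ ω ∂P, ∀ i ∈ D, X i ω = (hX i).mk (X i) ω :=
    (ae_ball_iff hDc).2 fun i _ => (hX i).ae_eq_mk
  obtain ⟨S, hS, hSm, hSp⟩ := (hc.and hDae).exists_measurable_mem
  refine ⟨fun i => S.indicator (X i), fun ω => ?_, fun i => ?_, ?_⟩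
  · by_cases h : ω ∈ S
    · simpa [h] using (hSp ω h).1
    · simpa [h] using continuous_const
  -- On `S` the process agrees with measurable versions along the countable set `D`; any other
  -- marginal is a limit along a sequence in `D`.
  · obtain ⟨u, hu, hlim⟩ := mem_closure_iff_seq_limit.1 (hD i)
    refine measurable_of_tendsto_metrizable
      (f := fun n => S.indicator ((hX (u n)).mk (X (u n))))
      (fun n => (hX (u n)).measurable_mk.indicator hSm) (tendsto_pi_nhds.2 fun ω => ?_)
    by_cases h : ω ∈ S
    · simp only [h, Set.indicator_of_mem]
      simp_rw [← (hSp ω h).2 _ (hu _)]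
      exact ((hSp ω h).1.tendsto i).comp hlim
    · simp [h]
  · filter_upwards [hS] with ω hω i
    simp [hω]

lemma fractionalOU_eq_ouTransform {Ω : Type*} (β : ℝ≥0 → Ω → ℝ) (lam : ℝ) (t : ℝ≥0) (ω : Ω) :
    fractionalOU β lam t ω = ouTransform lam (fun s => β s.toNNReal ω) t := by
  have hd : ∀ s : ℝ, deriv (fun s : ℝ => Real.exp (-lam * ((t : ℝ) - s))) s
      = lam * Real.exp (-lam * ((t : ℝ) - s)) := fun s => by
    have h : HasDerivAt (fun s : ℝ => -lam * ((t : ℝ) - s)) lam s := by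
      simpa using ((hasDerivAt_id s).const_sub (t : ℝ)).const_mul (-lam)
    rw [h.exp.deriv, mul_comm]
  simp only [fractionalOU, stochIntegral, ouTransform, hd]
  simp

theorem mainTheorem11 (H : ℝ) (hH0 : 0 < H) (hH : H < 1 / 2)
    (α : ℝ) (hα0 : 0 < α) (hα : α < 2 * H) :
    ∃ C : ℝ, 0 < C ∧
      ∀ (Ω : Type*) [MeasurableSpace Ω] (P : Measure Ω) [IsProbabilityMeasure P]
        (β : ℝ≥0 → Ω → ℝ), IsFractionalBrownianMotion H β P →
        ∀ lam : ℝ, 0 < lam → ∀ t₁ t₂ : ℝ≥0,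
          MemLp (fun ω => fractionalOU β lam t₂ ω - fractionalOU β lam t₁ ω) 2 P ∧
          ∫ ω, |fractionalOU β lam t₂ ω - fractionalOU β lam t₁ ω| ^ 2 ∂P ≤
            C * lam ^ (α - 2 * H) * |(t₂ : ℝ) - (t₁ : ℝ)| ^ α := by
  refine ⟨48, by norm_num, fun Ω _ P _ β hβ lam hlam t₁ t₂ => ?_⟩
  have hβL : ∀ t, MemLp (β t) 2 P := fun t => (hβ.isGaussianProcess.hasGaussianLaw_eval t).memLp_two
  have hβ2 : ∀ t : ℝ≥0, ∫ ω, β t ω ^ 2 ∂P = (t : ℝ) ^ (2 * H) := fun t => by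
    have h := hβ.covariance_eq t t
    simp only [← sq, sub_self, abs_zero, Real.zero_rpow (by positivity : 2 * H ≠ 0)] at h
    rw [h]
    ring
  have hβv : ∀ s t : ℝ≥0, ∫ ω, (β t ω - β s ω) ^ 2 ∂P = |(t : ℝ) - s| ^ (2 * H) := fun s t => by
    have hts : Integrable (fun ω => 2 * (β t ω * β s ω)) P :=
      ((hβL t).integrable_mul (hβL s)).const_mul 2
    have e : ∀ ω, (β t ω - β s ω) ^ 2 = β t ω ^ 2 - 2 * (β t ω * β s ω) + β s ω ^ 2 :=
      fun ω => by ring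
    simp_rw [e]
    have hsub : Integrable (fun ω => β t ω ^ 2 - 2 * (β t ω * β s ω)) P :=
      (hβL t).integrable_sq.sub hts
    rw [integral_add hsub (hβL s).integrable_sq,
      integral_sub (hβL t).integrable_sq hts, integral_const_mul, hβ.covariance_eq, hβ2, hβ2]
    ring
  -- Joint measurability and the pathwise identities need every path continuous. The exceptional
  -- null set is common to all times, so the path integrals agree too.
  obtain ⟨γ, hγc, hγm, hγ⟩ := exists_continuous_measurable_ae_eq
    (fun t => (hβL t).aestronglyMeasurable.aemeasurable) hβ.continuous_paths
  have hγt : ∀ t, γ t =ᵐ[P] β t := fun t => hγ.mono fun ω h => h t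
  set G : ℝ → Ω → ℝ := fun s => γ s.toNNReal with hGdef
  have key := fun a t => ouTransform_sub_memLp (P := P) (G := G) (p := 2 * H) (lam := lam)
    (by positivity) (by linarith) hlam (fun ω => (hγc ω).comp continuous_real_toNNReal)
    (fun s => hγm _) (fun s => (memLp_congr_ae (hγt _)).2 (hβL _))
    (fun t ht => by
      conv_rhs => rw [← Real.coe_toNNReal t ht, ← hβ2]
      refine integral_congr_ae ((hγt t.toNNReal).mono fun ω h => ?_)
      simp [hGdef, h])
    (fun s t hs ht => by
      conv_rhs => rw [← Real.coe_toNNReal t ht, ← Real.coe_toNNReal s hs, ← hβv]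
      refine integral_congr_ae (((hγt t.toNNReal).and (hγt s.toNNReal)).mono fun ω h => ?_)
      simp [hGdef, h.1, h.2]) (a := a) (t := t)
  have hae : (fun ω => fractionalOU β lam t₂ ω - fractionalOU β lam t₁ ω) =ᵐ[P]
      fun ω => ouTransform lam (fun s => G s ω) t₂ - ouTransform lam (fun s => G s ω) t₁ := by
    filter_upwards [hγ] with ω h
    simp only [fractionalOU_eq_ouTransform, hGdef, h]
  have main : MemLp (fun ω => ouTransform lam (fun s => G s ω) t₂
        - ouTransform lam (fun s => G s ω) t₁) 2 P ∧
      ∫ ω, (ouTransform lam (fun s => G s ω) t₂ - ouTransform lam (fun s => G s ω) t₁) ^ 2 ∂P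
        ≤ 48 * lam ^ (α - 2 * H) * |(t₂ : ℝ) - (t₁ : ℝ)| ^ α := by
    rcases le_total t₁ t₂ with h | h
    · obtain ⟨h1, h2, h3⟩ := key t₁ t₂ t₁.2 (by exact_mod_cast h)
      have h' : (t₁ : ℝ) ≤ t₂ := by exact_mod_cast h
      rw [abs_of_nonneg (sub_nonneg.2 h')]
      exact ⟨h1, le_rpow_interpolate hα0.le hα.le hlam (sub_nonneg.2 h') (by norm_num) h2 h3⟩
    · obtain ⟨h1, h2, h3⟩ := key t₂ t₁ t₂.2 (by exact_mod_cast h)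
      have h' : (t₂ : ℝ) ≤ t₁ := by exact_mod_cast h
      rw [abs_sub_comm, abs_of_nonneg (sub_nonneg.2 h')]
      simp_rw [fun ω => sub_sq_comm (ouTransform lam (fun s => G s ω) t₂)]
      refine ⟨?_, le_rpow_interpolate hα0.le hα.le hlam (sub_nonneg.2 h') (by norm_num) h2 h3⟩
      simpa [Pi.neg_def] using h1.neg
  refine ⟨(memLp_congr_ae hae).2 main.1, ?_⟩
  simp_rw [sq_abs]
  refine (integral_congr_ae (hae.mono fun ω h => ?_)).trans_le main.2
  simp only [h]
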